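/- Let $n,k$ be positive integers with $n\le k$, let $0\le r\le n$, and write $[m]=\{1,\dots,m\}$. Let $\rho=(\rho_1,\dots,\rho_k)$ be integers with $1\le\rho_\ell\le n$ for all $\ell\in[k]$ and $\sum_{\ell\in[k]}\rho_\ell=n^2$, and let $d=(d_1,\dots,d_k)$ be non-negative integers with $\sum_{\ell\in[k]}d_\ell=n-r$. An $r\times r$ *$\rho$-latin rectangle* is an $r\times r$ array with entries in $[k]$ in which each symbol occurs at most once in each row and at most once in each column, and each symbol $\ell$ occurs at most $\rho_\ell$ times in total. A *$\rho$-latin square* of order $n$ is an $n\times n$ array with entries in $[k]$ in which each symbol occurs at most once in each row and at most once in each column, and each symbol $\ell$ occurs exactly $\rho_\ell$ times in total. Such an array $L$ is *symmetric* if $L_{ij}=L_{ji}$ for all $i,j$. An $n\times n$ array $L'$ *completes* an $r\times r$ array $L$ if $L'_{ij}=L_{ij}$ for all $i,j\in[r]$; it has *diagonal tail* $d$ if, for each $\ell\in[k]$, exactly $d_\ell$ of the indices $i$ with $r+1\le i\le n$ satisfy $L'_{ii}=\ell$. Let $L$ be an $r\times r$ symmetric $\rho$-latin rectangle. For $\ell\in[k]$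 let $e_\ell$ be the number of occurrences of $\ell$ in $L$. For $I\subseteq[r]$ and $K\subseteq[k]$ let $\mu_I(\ell)$ be the number of rows in $I$ in which the symbol $\ell$ is missing, let $\mu_K(i)$ be the number of symbols in $K$ that are missing in row $i$ of $L$, and let $\bar K=[k]\setminus K$. Write $x\mathbin{\dot-}y=\max\{0,x-y\}$. Call $L$ *$(\rho,d)$-admissible* if, for all $\ell\in[k]$, $\rho_\ell-e_\ell+d_\ell\le 2(n-r)$ and $\rho_\ell-e_\ell+d_\ell$ is even. Consider the conditions $$(n-r)|I|\le\sum_{\ell\in[k]}\min\Big\{\frac{\rho_\ell-e_\ell-d_\ell}{2},\,\mu_I(\ell)\Big\}\qquad\text{for all } I\subseteq[r],\tag{1}$$ $$\sum_{\ell\in K}\big((\rho_\ell-e_\ell+r)\mathbin{\dot-}n\big)\le\sum_{i\in[r]}\min\{n-r,\,\mu_K(i)\}\qquad\text{for all } K\subseteq[k],\tag{2}$$ and $$(n-r)(r-|I|)+\sum_{\ell\in\bar K}\frac{\rho_\ell-e_\ell-d_\ell}{2}\ \ge\ \sum_{\ell\in K}\big((\rho_\ell-e_\ell-n+r)\mathbin{\dot-}\mu_I(\ell)\big)+\sum_{i\in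 I}\big((n-r)\mathbin{\dot-}\mu_K(i)\big)\qquad\text{for all } I\subseteq[r],\ K\subseteq[k].\tag{3}$$ **Theorem.** $L$ can be completed to an $n\times n$ symmetric $\rho$-latin square with diagonal tail $d$ if and only if $L$ is $(\rho,d)$-admissible and either both (1) and (2) hold, or (3) holds. Moreover, if $L$ is $(\rho,d)$-admissible, then (1) and (2) both hold if and only if (3) holds, so either alternative alone, together with admissibility, characterizes completability. -/

import Mathlib

namespace RhoLatin

open Finset

/-- The number `e_ℓ` of cells of the array `L` that contain the symbol `ℓ`. -/
def occ {r s k : ℕ} (L : Matrix (Fin r) (Fin s) (Fin k)) (ℓ : Fin k) : ℕ :=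
  #{p : Fin r × Fin s | L p.1 p.2 = ℓ}

/-- `L` is an `r × s` `ρ`-latin rectangle: each symbol occurs at most once in each row and
at most once in each column, and the symbol `ℓ` occurs at most `ρ ℓ` times. -/
structure IsRectangle {r s k : ℕ} (ρ : Fin k → ℕ) (L : Matrix (Fin r) (Fin s) (Fin k)) :
    Prop where
  row : ∀ i, Function.Injective fun j => L i j
  col : ∀ j, Function.Injective fun i => L i j
  occ_le : ∀ ℓ, occ L ℓ ≤ ρ ℓ

/-- `L` is a `ρ`-latin square of order `n`: each symbol occurs at most once in each row and
at most once in each column, and the symbol `ℓ` occurs exactly `ρ ℓ` times. -/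
structure IsSquare {n k : ℕ} (ρ : Fin k → ℕ) (L : Matrix (Fin n) (Fin n) (Fin k)) :
    Prop where
  row : ∀ i, Function.Injective fun j => L i j
  col : ∀ j, Function.Injective fun i => L i j
  occ_eq : ∀ ℓ, occ L ℓ = ρ ℓ

/-- `L'` contains `L` as its top left `r × r` subarray. -/
def Extends {r n k : ℕ} (h : r ≤ n) (L : Matrix (Fin r) (Fin r) (Fin k))
    (L' : Matrix (Fin n) (Fin n) (Fin k)) : Prop :=
  ∀ i j : Fin r, L' (Fin.castLE h i) (Fin.castLE h j) = L i j

/-- The diagonal tail of `L'`: how often `ℓ` occurs among the diagonal entries of `L'` after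
the first `r` ones (indices start at `0`). -/
def diagonalTail {n k : ℕ} (r : ℕ) (L' : Matrix (Fin n) (Fin n) (Fin k)) (ℓ : Fin k) : ℕ :=
  #{i : Fin n | r ≤ (i : ℕ) ∧ L' i i = ℓ}

/-- `L` can be completed to an `n × n` symmetric `ρ`-latin square with diagonal tail `d`. -/
def CompletableWithTail {r n k : ℕ} (h : r ≤ n) (ρ d : Fin k → ℕ)
    (L : Matrix (Fin r) (Fin r) (Fin k)) : Prop :=
  ∃ L' : Matrix (Fin n) (Fin n) (Fin k),
    IsSquare ρ L' ∧ L'.IsSymm ∧ Extends h L L' ∧ diagonalTail r L' = d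

/-- The symbol `ℓ` does not occur in row `i` of `L`. -/
def Missing {r k : ℕ} (L : Matrix (Fin r) (Fin r) (Fin k)) (i : Fin r) (ℓ : Fin k) : Prop :=
  ∀ j : Fin r, L i j ≠ ℓ

instance {r k : ℕ} (L : Matrix (Fin r) (Fin r) (Fin k)) (i : Fin r) (ℓ : Fin k) :
    Decidable (Missing L i ℓ) :=
  inferInstanceAs (Decidable (∀ j : Fin r, L i j ≠ ℓ))

/-- `μ_K(i)`: the number of symbols in `K` that are missing in row `i` of `L`. -/
def missingSymbols {r k : ℕ} (L : Matrix (Fin r) (Fin r) (Fin k)) (K : Finset (Fin k))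
    (i : Fin r) : ℕ :=
  #{ℓ ∈ K | Missing L i ℓ}

/-- `μ_I(ℓ)`: the number of rows in `I` where the symbol `ℓ` is missing. -/
def missingRows {r k : ℕ} (L : Matrix (Fin r) (Fin r) (Fin k)) (I : Finset (Fin r))
    (ℓ : Fin k) : ℕ :=
  #{i ∈ I | Missing L i ℓ}

/-- `x ∸ y = max {0, x - y}`. -/
def monus (x y : ℚ) : ℚ := max 0 (x - y)

/-- `(ρ, d)`-admissibility. -/
def Admissible {r k : ℕ} (n : ℕ) (ρ d : Fin k → ℕ) (L : Matrix (Fin r) (Fin r) (Fin k)) :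
    Prop :=
  (∀ ℓ, (ρ ℓ : ℤ) - occ L ℓ + d ℓ ≤ 2 * ((n : ℤ) - r)) ∧
    ∀ ℓ, (ρ ℓ : ℤ) - occ L ℓ + d ℓ ≡ 0 [ZMOD 2]

/-- `(n - r)|I| ≤ ∑_{ℓ ∈ [k]} min {(ρ_ℓ - e_ℓ - d_ℓ)/2, μ_I(ℓ)}` for all `I ⊆ [r]`. -/
def RowCondition {r k : ℕ} (n : ℕ) (ρ d : Fin k → ℕ) (L : Matrix (Fin r) (Fin r) (Fin k)) :
    Prop :=
  ∀ I : Finset (Fin r),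
    ((n : ℚ) - r) * #I ≤
      ∑ ℓ : Fin k, min (((ρ ℓ : ℚ) - occ L ℓ - d ℓ) / 2) (missingRows L I ℓ : ℚ)

/-- `∑_{ℓ ∈ K} (ρ_ℓ - e_ℓ + r ∸ n) ≤ ∑_{i ∈ [r]} min {n - r, μ_K(i)}` for all `K ⊆ [k]`. -/
def SymbolCondition {r k : ℕ} (n : ℕ) (ρ : Fin k → ℕ) (L : Matrix (Fin r) (Fin r) (Fin k)) :
    Prop :=
  ∀ K : Finset (Fin k),
    ∑ ℓ ∈ K, monus ((ρ ℓ : ℚ) - occ L ℓ + r) n ≤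
      ∑ i : Fin r, min ((n : ℚ) - r) (missingSymbols L K i : ℚ)

/-- `(n - r)(r - |I|) + ∑_{ℓ ∉ K} (ρ_ℓ - e_ℓ - d_ℓ)/2 ≥
∑_{ℓ ∈ K} (ρ_ℓ - e_ℓ - n + r ∸ μ_I(ℓ)) + ∑_{i ∈ I} (n - r ∸ μ_K(i))`
for all `I ⊆ [r]` and `K ⊆ [k]`. -/
def JointCondition {r k : ℕ} (n : ℕ) (ρ d : Fin k → ℕ) (L : Matrix (Fin r) (Fin r) (Fin k)) :
    Prop :=
  ∀ (I : Finset (Fin r)) (K : Finset (Fin k)),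
    ((n : ℚ) - r) * ((r : ℚ) - #I) + ∑ ℓ ∈ Kᶜ, ((ρ ℓ : ℚ) - occ L ℓ - d ℓ) / 2 ≥
      ∑ ℓ ∈ K, monus ((ρ ℓ : ℚ) - occ L ℓ - n + r) (missingRows L I ℓ) +
        ∑ i ∈ I, monus ((n : ℚ) - r) (missingSymbols L K i)

end RhoLatin

/-!
Put `m = n - r`. Merging the last `m` indices of a symmetric completion of `L` leaves an
*outline*: for each row `i` of `L` the set `H i` of the `m` symbols that row `i` still receives, and
for each symbol `ℓ` the numbers `d ℓ` and `2 c ℓ` of its diagonal and off-diagonal occurrences in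
the bottom right block. With `a ℓ` the number of rows `i` such that `ℓ ∈ H i`, the constraints are
`ρ ℓ = e ℓ + 2 a ℓ + 2 c ℓ + d ℓ` and `a ℓ + 2 c ℓ + d ℓ ≤ m`.

Conversely, every outline comes from a completion. The new rows are split off one at a time
(`Outline.exists_extension`): dividing the contents of the outline evenly among the `m` merged
indices is a fractional choice of symbols for one new row, and the theorem of Birkhoff and von
Neumann rounds it to an actual choice in which every symbol with `a ℓ + 2 c ℓ + d ℓ = m` is used
(`exists_injective_of_fractional`). What is left is an outline of the enlarged array with
`m - 1` in place of `m`.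

Hence `L` is completable exactly if it has an outline. Eliminating `c`, an outline is a subgraph of
the bipartite graph of rows and missing symbols with degree `m` at each row and degree between
`ρ ℓ - e ℓ - m` and `(ρ ℓ - e ℓ - d ℓ) / 2` at each symbol. An outline implies admissibility and,
by counting edges, the joint condition (`Outline.jointCondition`). The joint condition implies the
row condition and the symbol condition by specializing it to all rows or to all symbols. These two,
together with admissibility, give the subgraph by Hall's theorem
(`exists_subgraph_of_degree_bounds`).
-/

namespace RhoLatin

open Finset

/-! ### Matchings and subgraphs with prescribed degrees -/

/-- A fractional matching `w` of all of `S` into `T` can be rounded to a matching that covers every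
element of `T` at which `w` has total weight one. -/
theorem exists_injective_of_fractional {S T : Type*} [Fintype S] [Fintype T]
    [DecidableEq S] [DecidableEq T] (w : S → T → ℚ) (hw : ∀ s t, 0 ≤ w s t)
    (hrow : ∀ s, ∑ t, w s t = 1) (hcol : ∀ t, ∑ s, w s t ≤ 1) :
    ∃ f : S → T, Function.Injective f ∧ (∀ s, 0 < w s (f s)) ∧
      ∀ t, ∑ s, w s t = 1 → t ∈ Set.range f := by
  -- Two copies of `w`, glued along a diagonal block that makes up for the missing weight in `T`,
  -- form a doubly stochastic matrix.
  let M : Matrix (S ⊕ T) (S ⊕ T) ℚ :=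
    (Matrix.fromBlocks (Matrix.of w) 0
      (Matrix.diagonal fun t => 1 - ∑ s, w s t) (Matrix.of fun t s => w s t)).submatrix
        id (Equiv.sumComm S T)
  have hM : M ∈ doublyStochastic ℚ (S ⊕ T) := by
    rw [mem_doublyStochastic_iff_sum]
    refine ⟨?_, ?_, ?_⟩
    · rintro (s | t) (s' | t')
      · simp [M]
      · simpa [M] using hw s t'
      · simpa [M] using hw s' t
      · by_cases h : t = t'
        · subst h; simpa [M] using hcol t
        · simp [M, h]
    · rintro (s | t)
      · simp [M, hrow]
      · simp [M, Matrix.diagonal_apply]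
    · rintro (s | t)
      · simp [M, hrow]
      · simp [M, Matrix.diagonal_apply]
  obtain ⟨q, hq0, hq1, hqM⟩ := exists_eq_sum_perm_of_mem_doublyStochastic hM
  obtain ⟨σ, hσ⟩ : ∃ σ, 0 < q σ := by
    by_contra! h
    have : ∑ σ, q σ ≤ 0 := Finset.sum_nonpos fun σ _ => h σ
    linarith
  have hpos : ∀ x, 0 < M x (σ x) := by
    intro x
    rw [← hqM, Matrix.sum_apply]
    refine Finset.sum_pos' (fun τ _ => ?_) ⟨σ, mem_univ _, ?_⟩
    · have := hq0 τ
      simp only [Matrix.smul_apply, smul_eq_mul, Equiv.Perm.permMatrix,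
        PEquiv.toMatrix_apply]
      split_ifs <;> simp [this]
    · simp [Equiv.Perm.permMatrix, PEquiv.toMatrix_apply, hσ]
  have key : ∀ s, ∃ t, σ (Sum.inl s) = Sum.inr t ∧ 0 < w s t := by
    intro s
    have := hpos (Sum.inl s)
    rcases hx : σ (Sum.inl s) with s' | t
    · rw [hx] at this; simp [M] at this
    · rw [hx] at this; exact ⟨t, rfl, by simpa [M] using this⟩
  choose f hf hfw using key
  refine ⟨f, fun s s' h => ?_, hfw, fun t ht => ?_⟩
  · have : σ (Sum.inl s) = σ (Sum.inl s') := by rw [hf, hf, h]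
    simpa using this
  · obtain ⟨x, hx⟩ := σ.surjective (Sum.inr t)
    rcases x with s | t'
    · rw [hf] at hx
      exact ⟨s, by simpa using hx⟩
    · have := hpos (Sum.inr t')
      rw [hx] at this
      by_cases h : t' = t
      · subst h; simp [M, ht] at this
      · simp [M, h] at this

/-- A bipartite graph with neighbourhoods `N i` has a subgraph with degree `b i` at each `i` and
degree between `lo ℓ` and `hi ℓ` at each `ℓ` if the two cut conditions hold.

This is a single case of Hall's theorem. Give each `i` a supply of `#(N i) - b i` slots and each
`ℓ` a supply of `hi ℓ` slots. Every edge takes a slot of one of its two ends, and it belongs to the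
subgraph if this is the end `ℓ`. Dummies, as many as there are slots left over, fill the remaining
slots; they may take only those slots of `ℓ` whose index is at least `lo ℓ`. -/
theorem exists_subgraph_of_degree_bounds {ι κ : Type*} [Fintype ι] [Fintype κ]
    [DecidableEq ι] [DecidableEq κ] (N : ι → Finset κ) (b : ι → ℕ) (lo hi : κ → ℕ)
    (hlo : ∀ ℓ, lo ℓ ≤ hi ℓ)
    (h₁ : ∀ (I : Finset ι) (K : Finset κ),
      ∑ i ∈ I, b i ≤ ∑ i ∈ I, #(N i \ K) + ∑ ℓ ∈ K, hi ℓ)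
    (h₂ : ∀ (I : Finset ι) (K : Finset κ),
      ∑ ℓ ∈ Kᶜ, lo ℓ ≤ ∑ i ∈ Iᶜ, b i + ∑ i ∈ I, #(N i \ K)) :
    ∃ H : ι → Finset κ, (∀ i, H i ⊆ N i) ∧ (∀ i, #(H i) = b i) ∧
      ∀ ℓ, lo ℓ ≤ #{i | ℓ ∈ H i} ∧ #{i | ℓ ∈ H i} ≤ hi ℓ := by
  have hbN : ∀ i, b i ≤ #(N i) := fun i => by simpa using h₁ {i} ∅
  have hbhi : ∑ i, b i ≤ ∑ ℓ, hi ℓ := by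
    have h : ∀ i, N i \ univ = ∅ := fun i => sdiff_eq_empty_iff_subset.2 (subset_univ _)
    simpa only [h, card_empty, sum_const_zero, zero_add] using h₁ univ univ
  let E := {p : ι × κ // p.2 ∈ N p.1}
  let A := E ⊕ Fin (∑ ℓ, hi ℓ - ∑ i, b i)
  let B := (Σ i, Fin (#(N i) - b i)) ⊕ (Σ ℓ, Fin (hi ℓ))
  let nb : A → Finset B := Sum.elim
    (fun e => ({e.1.1} : Finset ι).sigma (fun _ => univ) |>.disjSum
      (({e.1.2} : Finset κ).sigma fun _ => univ))
    (fun _ => (∅ : Finset (Σ i, Fin (#(N i) - b i))).disjSum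
      (univ.sigma fun ℓ => {t : Fin (hi ℓ) | lo ℓ ≤ t}))
  have hopt : ∀ ℓ, #{t : Fin (hi ℓ) | lo ℓ ≤ t} = hi ℓ - lo ℓ := fun ℓ => by
    have h := Finset.card_filter_add_card_filter_not (s := (univ : Finset (Fin (hi ℓ))))
      (fun t => lo ℓ ≤ (t : ℕ))
    have h' : #{t : Fin (hi ℓ) | ¬ lo ℓ ≤ t} = lo ℓ := by
      have := Fin.card_filter_val_lt (n := hi ℓ) (m := lo ℓ)
      simp only [not_le]
      simpa [hlo ℓ] using this
    simp only [card_univ, Fintype.card_fin] at h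
    omega
  have hsub : ∀ (I : Finset ι) (K : Finset κ),
      ∑ i ∈ I, #(N i ∩ K) + ∑ i ∈ I, #(N i \ K) = ∑ i ∈ I, #(N i) := fun I K => by
    rw [← sum_add_distrib]
    exact sum_congr rfl fun i _ => card_inter_add_card_sdiff _ _
  have hcard : Fintype.card A = Fintype.card B := by
    have hE : Fintype.card E = ∑ i, #(N i) := by
      rw [Fintype.card_subtype, ← univ_product_univ]
      rw [Finset.card_filter, Finset.sum_product]
      refine sum_congr rfl fun i _ => ?_
      simp
    have := sum_tsub_distrib univ (fun i _ => hbN i)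
    have := sum_le_sum (fun i (_ : i ∈ univ) => hbN i)
    simp only [A, B, Fintype.card_sum, hE, Fintype.card_sigma, Fintype.card_fin]
    omega
  have hall : ∀ X : Finset A, #X ≤ #(X.biUnion nb) := by
    intro X
    let I : Finset ι := X.toLeft.image fun e => e.1.1
    let K : Finset κ := X.toLeft.image fun e => e.1.2
    have hX : #X.toLeft ≤ ∑ i ∈ I, #(N i ∩ K) := by
      rw [← card_sigma]
      refine card_le_card_of_injOn (fun e => ⟨e.1.1, e.1.2⟩) (fun e he => ?_)
        fun e _ e' _ h => ?_
      · have he' := mem_coe.1 he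
        simp only [coe_sigma, Set.mem_sigma_iff, mem_coe, mem_inter]
        exact ⟨mem_image_of_mem _ he', e.2, mem_image_of_mem _ he'⟩
      · simp only [Sigma.mk.injEq, heq_eq_eq] at h
        exact Subtype.ext (Prod.ext h.1 h.2)
    have hIK := hsub I K
    have hIb := sum_tsub_distrib I (fun i _ => hbN i)
    have hIb' := sum_le_sum (fun i (_ : i ∈ I) => hbN i)
    have hbI := sum_add_sum_compl I b
    have hlK := sum_add_sum_compl K lo
    have hhK := sum_add_sum_compl K hi
    rw [← card_toLeft_add_card_toRight]
    -- Without dummies, Hall's condition is the first cut condition; with them, it is the second.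
    by_cases hD : X.toRight = ∅
    · have hle : #((I.sigma fun i => (univ : Finset (Fin (#(N i) - b i)))).disjSum
          (K.sigma fun ℓ => (univ : Finset (Fin (hi ℓ))))) ≤ #(X.biUnion nb) := by
        refine card_le_card fun y hy => ?_
        rw [mem_biUnion]
        rcases y with ⟨i, t⟩ | ⟨ℓ, t⟩
        · obtain ⟨e, he, rfl⟩ : ∃ e ∈ X.toLeft, e.1.1 = i := by simpa [I] using hy
          exact ⟨Sum.inl e, by simpa using he, by simp [nb]⟩
        · obtain ⟨e, he, rfl⟩ : ∃ e ∈ X.toLeft, e.1.2 = ℓ := by simpa [K] using hy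
          exact ⟨Sum.inl e, by simpa using he, by simp [nb]⟩
      refine le_trans ?_ hle
      rw [hD]
      simp only [card_disjSum, card_sigma, card_univ, Fintype.card_fin, card_empty]
      have := h₁ I K
      omega
    · obtain ⟨δ, hδ⟩ := nonempty_iff_ne_empty.2 hD
      have hle : #((I.sigma fun i => (univ : Finset (Fin (#(N i) - b i)))).disjSum
          (univ.sigma fun ℓ => if ℓ ∈ K then (univ : Finset (Fin (hi ℓ))) else
            univ.filter fun t => lo ℓ ≤ (t : ℕ))) ≤ #(X.biUnion nb) := by
        refine card_le_card fun y hy => ?_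
        rw [mem_biUnion]
        rcases y with ⟨i, t⟩ | ⟨ℓ, t⟩
        · obtain ⟨e, he, rfl⟩ : ∃ e ∈ X.toLeft, e.1.1 = i := by simpa [I] using hy
          exact ⟨Sum.inl e, by simpa using he, by simp [nb]⟩
        · by_cases hℓ : ℓ ∈ K
          · obtain ⟨e, he, rfl⟩ : ∃ e ∈ X.toLeft, e.1.2 = ℓ := by simpa [K] using hℓ
            exact ⟨Sum.inl e, by simpa using he, by simp [nb]⟩
          · exact ⟨Sum.inr δ, by simpa using hδ, by simpa [nb, hℓ] using hy⟩
      refine le_trans ?_ hle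
      have hR : #X.toRight ≤ ∑ ℓ, hi ℓ - ∑ i, b i := by
        simpa using card_le_univ X.toRight
      have hS : ∑ ℓ, #(if ℓ ∈ K then (univ : Finset (Fin (hi ℓ))) else
          univ.filter fun t => lo ℓ ≤ (t : ℕ)) = ∑ ℓ ∈ K, hi ℓ + ∑ ℓ ∈ Kᶜ, (hi ℓ - lo ℓ) := by
        rw [← sum_add_sum_compl K]
        congr 1
        · exact sum_congr rfl fun ℓ h => by simp [h]
        · exact sum_congr rfl fun ℓ h => by rw [if_neg (mem_compl.1 h), hopt]
      simp only [card_disjSum, card_sigma, hS, card_univ, Fintype.card_fin]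
      have := sum_tsub_distrib Kᶜ (fun ℓ _ => hlo ℓ)
      have := sum_le_sum (fun ℓ (_ : ℓ ∈ Kᶜ) => hlo ℓ)
      have := h₂ I K
      omega
  obtain ⟨f, hf, hfnb⟩ := (all_card_le_biUnion_card_iff_exists_injective nb).1 hall
  -- There are as many slots as edges and dummies, so every slot is taken.
  have hsurj : Function.Surjective f :=
    ((Fintype.bijective_iff_injective_and_card f).2 ⟨hf, hcard⟩).2
  have hleft : ∀ e : E, ∀ i t, f (Sum.inl e) = Sum.inl ⟨i, t⟩ → e.1.1 = i := by
    intro e i t h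
    have := hfnb (Sum.inl e)
    rw [h] at this
    exact (mem_singleton.1 (mem_sigma.1 (inl_mem_disjSum.1 this)).1).symm
  have hright : ∀ e : E, ∀ ℓ t, f (Sum.inl e) = Sum.inr ⟨ℓ, t⟩ → e.1.2 = ℓ := by
    intro e ℓ t h
    have := hfnb (Sum.inl e)
    rw [h] at this
    exact (mem_singleton.1 (mem_sigma.1 (inr_mem_disjSum.1 this)).1).symm
  have hdummy : ∀ δ, ∃ ℓ t, f (Sum.inr δ) = Sum.inr ⟨ℓ, t⟩ ∧ lo ℓ ≤ (t : ℕ) := by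
    intro δ
    have := hfnb (Sum.inr δ)
    rcases h : f (Sum.inr δ) with ⟨i, t⟩ | ⟨ℓ, t⟩
    · rw [h] at this
      exact absurd (inl_mem_disjSum.1 this) (by simp)
    · rw [h] at this
      exact ⟨ℓ, t, rfl, (mem_filter.1 (mem_sigma.1 (inr_mem_disjSum.1 this)).2).2⟩
  let H : ι → Finset κ := fun i =>
    {ℓ ∈ N i | ∃ h : ℓ ∈ N i, (f (Sum.inl ⟨(i, ℓ), h⟩)).isRight = true}
  have hHN : ∀ i, H i ⊆ N i := fun i => filter_subset _ _
  -- The edges at `i` outside the subgraph correspond to the slots of `i`.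
  have hunused : ∀ i, #(N i \ H i) = #(N i) - b i := by
    intro i
    have key : ∀ ℓ : {ℓ // ℓ ∈ N i \ H i}, ∃ (h : ℓ.1 ∈ N i) (t : Fin (#(N i) - b i)),
        f (Sum.inl ⟨(i, ℓ.1), h⟩) = Sum.inl ⟨i, t⟩ := by
      rintro ⟨ℓ, hℓ⟩
      rw [mem_sdiff] at hℓ
      refine ⟨hℓ.1, ?_⟩
      rcases h : f (Sum.inl ⟨(i, ℓ), hℓ.1⟩) with ⟨i', t⟩ | y
      · obtain rfl := hleft _ _ _ h
        exact ⟨t, rfl⟩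
      · exact absurd (mem_filter.2 ⟨hℓ.1, hℓ.1, by rw [h]; rfl⟩) hℓ.2
    choose hg g hfg using key
    have hbij : Function.Bijective g := by
      constructor
      · intro x y hxy
        have : f (Sum.inl ⟨(i, x.1), hg x⟩) = f (Sum.inl ⟨(i, y.1), hg y⟩) := by
          rw [hfg, hfg, hxy]
        have := hf this
        exact Subtype.ext (congrArg (fun e : E => e.1.2) (Sum.inl.inj this))
      · intro t
        obtain ⟨x, hx⟩ := hsurj (Sum.inl ⟨i, t⟩)
        rcases x with ⟨⟨i', ℓ⟩, he⟩ | δ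
        · obtain rfl : i' = i := hleft _ _ _ hx
          have hℓ : ℓ ∈ N i' \ H i' := by
            refine mem_sdiff.2 ⟨he, fun h => ?_⟩
            obtain ⟨_, _, h⟩ := mem_filter.1 h
            rw [hx] at h
            simp at h
          refine ⟨⟨ℓ, hℓ⟩, ?_⟩
          have := hfg ⟨ℓ, hℓ⟩
          rw [hx] at this
          exact (eq_of_heq (Sigma.mk.inj (Sum.inl.inj this)).2).symm
        · obtain ⟨ℓ, s, h, _⟩ := hdummy δ
          rw [hx] at h
          simp at h
    have := Fintype.card_of_bijective hbij
    rwa [Fintype.card_fin, Fintype.card_coe] at this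
  refine ⟨H, hHN, fun i => ?_, fun ℓ => ⟨?_, ?_⟩⟩
  · have := card_sdiff_add_card_eq_card (hHN i)
    have := hunused i
    have := hbN i
    omega
  · -- The slots of `ℓ` with index below `lo ℓ` are taken by edges, as dummies may not take them.
    have key : ∀ t : Fin (lo ℓ), ∃ (i : ι) (h : ℓ ∈ N i),
        f (Sum.inl ⟨(i, ℓ), h⟩) = Sum.inr ⟨ℓ, Fin.castLE (hlo ℓ) t⟩ := by
      intro t
      obtain ⟨x, hx⟩ := hsurj (Sum.inr ⟨ℓ, Fin.castLE (hlo ℓ) t⟩)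
      rcases x with ⟨⟨i, ℓ'⟩, he⟩ | δ
      · obtain rfl : ℓ' = ℓ := hright _ _ _ hx
        exact ⟨i, he, hx⟩
      · obtain ⟨ℓ', s, h, hs⟩ := hdummy δ
        rw [hx] at h
        obtain ⟨rfl, h⟩ := Sigma.mk.inj (Sum.inr.inj h)
        replace h := eq_of_heq h
        rw [← h] at hs
        exact absurd t.2 (not_lt.2 hs)
    choose g hg hfg using key
    have := card_le_card_of_injOn (s := (univ : Finset (Fin (lo ℓ)))) (t := {i | ℓ ∈ H i}) g
      (fun t _ => by
        simp only [coe_filter, mem_univ, true_and, Set.mem_ofPred_eq]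
        exact mem_filter.2 ⟨hg t, hg t, by rw [hfg]; rfl⟩)
      (fun t _ t' _ h => by
        have h1 := hfg t
        have h2 := hfg t'
        have : f (Sum.inl ⟨(g t, ℓ), hg t⟩) = f (Sum.inl ⟨(g t', ℓ), hg t'⟩) := by
          congr 1; simp only [h]
        rw [h1, h2] at this
        exact Fin.castLE_injective _ (eq_of_heq (Sigma.mk.inj (Sum.inr.inj this)).2))
    simpa using this
  · have key : ∀ i : {i // ℓ ∈ H i}, ∃ (h : ℓ ∈ N i.1) (t : Fin (hi ℓ)),
        f (Sum.inl ⟨(i.1, ℓ), h⟩) = Sum.inr ⟨ℓ, t⟩ := by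
      rintro ⟨i, hi'⟩
      obtain ⟨_, h, h'⟩ := mem_filter.1 hi'
      refine ⟨h, ?_⟩
      rcases h'' : f (Sum.inl ⟨(i, ℓ), h⟩) with y | ⟨ℓ', t⟩
      · rw [h''] at h'; simp at h'
      · obtain rfl : ℓ = ℓ' := hright _ _ _ h''
        exact ⟨t, rfl⟩
    choose hg g hfg using key
    have hinj : Function.Injective g := by
      intro x y hxy
      have : f (Sum.inl ⟨(x.1, ℓ), hg x⟩) = f (Sum.inl ⟨(y.1, ℓ), hg y⟩) := by
        rw [hfg, hfg, hxy]
      have := hf this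
      exact Subtype.ext (congrArg (fun e : E => e.1.1) (Sum.inl.inj this))
    have := Fintype.card_le_of_injective g hinj
    rwa [Fintype.card_fin, Fintype.card_subtype] at this

/-! ### Outlines -/

/-- An outline is what remains of a completion of `L` by `m` rows and columns when the new indices
are merged into a single one. `H i` is the set of symbols that row `i` receives, `d ℓ` the number
of new diagonal cells with symbol `ℓ`, and `c ℓ` the number of pairs of symmetric off-diagonal
cells with symbol `ℓ` in the bottom right block. The last field says that the number of times `ℓ`
occurs in the `m` new columns is at most `m`. -/
structure Outline {r k : ℕ} (m : ℕ) (ρ d : Fin k → ℕ) (L : Matrix (Fin r) (Fin r) (Fin k))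
    (H : Fin r → Finset (Fin k)) (c : Fin k → ℕ) : Prop where
  missing : ∀ i, ∀ ℓ ∈ H i, Missing L i ℓ
  card_row : ∀ i, #(H i) = m
  occ_eq : ∀ ℓ, ρ ℓ = occ L ℓ + 2 * #{i | ℓ ∈ H i} + 2 * c ℓ + d ℓ
  le_order : ∀ ℓ, #{i | ℓ ∈ H i} + 2 * c ℓ + d ℓ ≤ m

theorem occ_eq_sum {r s k : ℕ} (L : Matrix (Fin r) (Fin s) (Fin k)) (ℓ : Fin k) :
    occ L ℓ = ∑ i, ∑ j, if L i j = ℓ then 1 else 0 := by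
  rw [occ, card_filter, ← univ_product_univ, sum_product]

theorem sum_occ {r s k : ℕ} (L : Matrix (Fin r) (Fin s) (Fin k)) :
    ∑ ℓ, occ L ℓ = r * s := by
  simp only [occ_eq_sum]
  rw [sum_comm, sum_congr rfl fun i _ => sum_comm]
  simp

theorem Outline.sum_eq {r k m : ℕ} {ρ d : Fin k → ℕ} {L : Matrix (Fin r) (Fin r) (Fin k)}
    {H : Fin r → Finset (Fin k)} {c : Fin k → ℕ} (h : Outline m ρ d L H c)
    (hρ : ∑ ℓ, ρ ℓ = (r + m) ^ 2) (hd : ∑ ℓ, d ℓ = m) :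
    2 * ∑ ℓ, c ℓ + m = m ^ 2 := by
  have hH : ∑ ℓ, #{i | ℓ ∈ H i} = r * m := by
    simp only [card_filter]
    rw [sum_comm]
    simp [h.card_row]
  have : ∑ ℓ, ρ ℓ = r * r + 2 * (r * m) + 2 * ∑ ℓ, c ℓ + m := by
    rw [← sum_occ L, ← hH, ← hd, mul_sum, mul_sum, ← sum_add_distrib, ← sum_add_distrib,
      ← sum_add_distrib]
    exact sum_congr rfl fun ℓ _ => h.occ_eq ℓ
  rw [hρ] at this
  linarith [this]

theorem Outline.admissible {r k m : ℕ} {ρ d : Fin k → ℕ}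
    {L : Matrix (Fin r) (Fin r) (Fin k)} {H : Fin r → Finset (Fin k)} {c : Fin k → ℕ}
    (h : Outline m ρ d L H c) : Admissible (r + m) ρ d L := by
  refine ⟨fun ℓ => ?_, fun ℓ => ?_⟩
  · have := h.occ_eq ℓ
    have := h.le_order ℓ
    push_cast
    omega
  · have := h.occ_eq ℓ
    rw [Int.modEq_zero_iff_dvd]
    omega

/-- Write `x(I, K)` for the number of pairs `(i, ℓ) ∈ I × K` with `ℓ ∈ H i`. The right side of the
joint condition is at most `x(Iᶜ, K) + x(I, Kᶜ)`, and the left side is at least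
`x(Iᶜ, univ) + x(univ, Kᶜ)`. -/
theorem Outline.jointCondition {r k m : ℕ} {ρ d : Fin k → ℕ}
    {L : Matrix (Fin r) (Fin r) (Fin k)} {H : Fin r → Finset (Fin k)} {c : Fin k → ℕ}
    (h : Outline m ρ d L H c) : JointCondition (r + m) ρ d L := by
  intro I K
  have hK : ∑ ℓ ∈ K, monus ((ρ ℓ : ℚ) - occ L ℓ - (r + m : ℕ) + r) (missingRows L I ℓ) ≤
      ∑ ℓ ∈ K, ∑ i ∈ Iᶜ, if ℓ ∈ H i then (1 : ℚ) else 0 := by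
    refine sum_le_sum fun ℓ _ => max_le (sum_nonneg fun i _ => by split_ifs <;> simp) ?_
    have h1 : #{i | ℓ ∈ H i} ≤ missingRows L I ℓ + #{i ∈ Iᶜ | ℓ ∈ H i} := by
      have : #{i ∈ I | ℓ ∈ H i} ≤ missingRows L I ℓ :=
        card_le_card (monotone_filter_right I fun i _ hi => h.missing i ℓ hi)
      have h' : #{i | ℓ ∈ H i} = #{i ∈ I | ℓ ∈ H i} + #{i ∈ Iᶜ | ℓ ∈ H i} := by
        simp only [card_filter]
        exact (sum_add_sum_compl I _).symm
      omega
    have h2 : ρ ℓ ≤ occ L ℓ + m + #{i | ℓ ∈ H i} := by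
      have := h.occ_eq ℓ
      have := h.le_order ℓ
      omega
    rw [sum_boole]
    have h3 : (ρ ℓ : ℚ) ≤ occ L ℓ + m + (missingRows L I ℓ + #{i ∈ Iᶜ | ℓ ∈ H i}) := by
      exact_mod_cast (by omega)
    push_cast
    linarith
  have hI : ∑ i ∈ I, monus (((r + m : ℕ) : ℚ) - r) (missingSymbols L K i) ≤
      ∑ i ∈ I, ∑ ℓ ∈ Kᶜ, if ℓ ∈ H i then (1 : ℚ) else 0 := by
    refine sum_le_sum fun i _ => max_le (sum_nonneg fun i _ => by split_ifs <;> simp) ?_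
    have h1 : m ≤ missingSymbols L K i + #{ℓ ∈ Kᶜ | ℓ ∈ H i} := by
      have : #{ℓ ∈ K | ℓ ∈ H i} ≤ missingSymbols L K i :=
        card_le_card (monotone_filter_right K fun ℓ _ hi => h.missing i ℓ hi)
      have h' : #{ℓ | ℓ ∈ H i} = #{ℓ ∈ K | ℓ ∈ H i} + #{ℓ ∈ Kᶜ | ℓ ∈ H i} := by
        simp only [card_filter]
        exact (sum_add_sum_compl K _).symm
      have := h.card_row i
      rw [filter_univ_mem] at h'
      omega
    rw [sum_boole]
    have h3 : (m : ℚ) ≤ missingSymbols L K i + #{ℓ ∈ Kᶜ | ℓ ∈ H i} := by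
      exact_mod_cast h1
    push_cast
    linarith
  have hI' : ∑ i ∈ Iᶜ, ∑ ℓ, (if ℓ ∈ H i then (1 : ℚ) else 0) = m * (r - #I) := by
    have : ∀ i, ∑ ℓ, (if ℓ ∈ H i then (1 : ℚ) else 0) = m := fun i => by
      rw [sum_boole, filter_univ_mem, h.card_row]
    simp only [this, sum_const, nsmul_eq_mul]
    rw [card_compl, Fintype.card_fin, Nat.cast_sub (by simpa using card_le_univ I)]
    ring
  have hK' : ∑ ℓ ∈ Kᶜ, ∑ i, (if ℓ ∈ H i then (1 : ℚ) else 0) ≤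
      ∑ ℓ ∈ Kᶜ, ((ρ ℓ : ℚ) - occ L ℓ - d ℓ) / 2 := by
    refine sum_le_sum fun ℓ _ => ?_
    rw [sum_boole]
    have : (ρ ℓ : ℚ) = occ L ℓ + 2 * #{i | ℓ ∈ H i} + 2 * c ℓ + d ℓ := by
      exact_mod_cast h.occ_eq ℓ
    have : (0 : ℚ) ≤ c ℓ := by positivity
    linarith
  have hs1 := sum_comm (s := K) (t := Iᶜ) (f := fun ℓ i => if ℓ ∈ H i then (1 : ℚ) else 0)
  have hs2 := sum_comm (s := Kᶜ) (t := univ) (f := fun ℓ i => if ℓ ∈ H i then (1 : ℚ) else 0)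
  have hs3 := sum_add_sum_compl I fun i => ∑ ℓ ∈ Kᶜ, if ℓ ∈ H i then (1 : ℚ) else 0
  have hs4 : ∑ i ∈ Iᶜ, ∑ ℓ, (if ℓ ∈ H i then (1 : ℚ) else 0) =
      ∑ i ∈ Iᶜ, ∑ ℓ ∈ K, (if ℓ ∈ H i then (1 : ℚ) else 0) +
        ∑ i ∈ Iᶜ, ∑ ℓ ∈ Kᶜ, (if ℓ ∈ H i then (1 : ℚ) else 0) := by
    rw [← sum_add_distrib]
    exact sum_congr rfl fun i _ => (sum_add_sum_compl K _).symm
  have hm : ((r + m : ℕ) : ℚ) - r = m := by push_cast; ring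
  have hs5 : 0 ≤ ∑ i ∈ Iᶜ, ∑ ℓ ∈ Kᶜ, (if ℓ ∈ H i then (1 : ℚ) else 0) :=
    sum_nonneg fun i _ => sum_nonneg fun ℓ _ => by split_ifs <;> simp
  rw [hm] at hI ⊢
  linarith

/-! ### The three conditions -/

/-- Double counting of the pairs `(i, ℓ) ∈ I × K` such that `ℓ` is missing in row `i`. -/
theorem sum_missingSymbols {r k : ℕ} (L : Matrix (Fin r) (Fin r) (Fin k))
    (I : Finset (Fin r)) (K : Finset (Fin k)) :
    ∑ i ∈ I, missingSymbols L K i = ∑ ℓ ∈ K, missingRows L I ℓ := by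
  simp only [missingSymbols, missingRows, card_filter]
  exact sum_comm

/-- The row condition for `I` is the joint condition for all rows and for the set of those symbols
at which the minimum is `μ_I(ℓ)`. -/
theorem JointCondition.rowCondition {n r k : ℕ} {ρ d : Fin k → ℕ}
    {L : Matrix (Fin r) (Fin r) (Fin k)} (h : JointCondition n ρ d L) :
    RowCondition n ρ d L := by
  intro I
  let K : Finset (Fin k) :=
    {ℓ | (missingRows L I ℓ : ℚ) < ((ρ ℓ : ℚ) - occ L ℓ - d ℓ) / 2}
  have hJ := h univ K
  have h1 : 0 ≤ ∑ ℓ ∈ K, monus ((ρ ℓ : ℚ) - occ L ℓ - n + r) (missingRows L univ ℓ) :=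
    sum_nonneg fun _ _ => le_max_left _ _
  have h2 : ∑ i ∈ I, (((n : ℚ) - r) - missingSymbols L K i) ≤
      ∑ i, monus ((n : ℚ) - r) (missingSymbols L K i) :=
    (sum_le_sum fun _ _ => le_max_right _ _).trans
      (sum_le_sum_of_subset_of_nonneg (subset_univ I) fun _ _ _ => le_max_left _ _)
  have h3 : ∑ ℓ : Fin k, min (((ρ ℓ : ℚ) - occ L ℓ - d ℓ) / 2) (missingRows L I ℓ : ℚ) =
      ∑ ℓ ∈ K, (missingRows L I ℓ : ℚ) + ∑ ℓ ∈ Kᶜ, ((ρ ℓ : ℚ) - occ L ℓ - d ℓ) / 2 := by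
    rw [← sum_add_sum_compl K]
    congr 1
    · exact sum_congr rfl fun ℓ hℓ => min_eq_right (mem_filter.1 hℓ).2.le
    · refine sum_congr rfl fun ℓ hℓ => min_eq_left ?_
      simpa [K] using hℓ
  have h4 : ∑ i ∈ I, (missingSymbols L K i : ℚ) = ∑ ℓ ∈ K, (missingRows L I ℓ : ℚ) := by
    exact_mod_cast sum_missingSymbols L I K
  rw [sum_sub_distrib, sum_const, nsmul_eq_mul, h4] at h2
  rw [h3]
  simp only [card_univ, Fintype.card_fin, sub_self, mul_zero, zero_add] at hJ
  linarith

/-- The symbol condition for `K` is the joint condition for all symbols and for the set of those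
rows at which the minimum is `μ_K(i)`. -/
theorem JointCondition.symbolCondition {n r k : ℕ} {ρ d : Fin k → ℕ}
    {L : Matrix (Fin r) (Fin r) (Fin k)} (h : JointCondition n ρ d L) :
    SymbolCondition n ρ L := by
  intro K
  let I : Finset (Fin r) := {i | (missingSymbols L K i : ℚ) < (n : ℚ) - r}
  have hJ := h I univ
  have h1 : 0 ≤ ∑ i ∈ I, monus ((n : ℚ) - r) (missingSymbols L univ i) :=
    sum_nonneg fun _ _ => le_max_left _ _
  have h2 : ∑ ℓ ∈ K, (monus ((ρ ℓ : ℚ) - occ L ℓ + r) n - missingRows L I ℓ) ≤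
      ∑ ℓ, monus ((ρ ℓ : ℚ) - occ L ℓ - n + r) (missingRows L I ℓ) := by
    refine (sum_le_sum fun ℓ _ => ?_).trans
      (sum_le_sum_of_subset_of_nonneg (subset_univ K) fun _ _ _ => le_max_left _ _)
    have : (0 : ℚ) ≤ missingRows L I ℓ := by positivity
    rw [sub_le_iff_le_add, monus, monus]
    refine max_le (add_nonneg (le_max_left _ _) this) ?_
    have := le_max_right 0 ((ρ ℓ : ℚ) - occ L ℓ - n + r - missingRows L I ℓ)
    linarith
  have h3 : ∑ i : Fin r, min ((n : ℚ) - r) (missingSymbols L K i : ℚ) =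
      ∑ i ∈ I, (missingSymbols L K i : ℚ) + ((n : ℚ) - r) * (r - #I) := by
    rw [← sum_add_sum_compl I]
    congr 1
    · exact sum_congr rfl fun ℓ hℓ => min_eq_right (mem_filter.1 hℓ).2.le
    · rw [sum_congr rfl fun i hi => min_eq_left (by simpa [I] using hi), sum_const,
        nsmul_eq_mul, card_compl, Fintype.card_fin,
        Nat.cast_sub (by simpa using card_le_univ I), mul_comm]
  have h4 : ∑ i ∈ I, (missingSymbols L K i : ℚ) = ∑ ℓ ∈ K, (missingRows L I ℓ : ℚ) := by
    exact_mod_cast sum_missingSymbols L I K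
  rw [sum_sub_distrib] at h2
  rw [h3, h4]
  simp only [compl_univ, sum_empty, add_zero] at hJ
  linarith

/-- The row condition and the symbol condition are the hypotheses under which the graph of missing
symbols has a subgraph with degree `m` at each row and degree between `ρ_ℓ - e_ℓ - m` and
`(ρ_ℓ - e_ℓ - d_ℓ) / 2` at each symbol. -/
theorem exists_outline {r k m : ℕ} {ρ d : Fin k → ℕ} {L : Matrix (Fin r) (Fin r) (Fin k)}
    (hA : Admissible (r + m) ρ d L) (hR : RowCondition (r + m) ρ d L)
    (hS : SymbolCondition (r + m) ρ L) :
    ∃ H c, Outline m ρ d L H c := by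
  have hm : ((r + m : ℕ) : ℚ) - r = m := by push_cast; ring
  -- The row condition for `I = ∅` says that the upper bounds are nonnegative.
  have hd : ∀ ℓ, occ L ℓ + d ℓ ≤ ρ ℓ := by
    have h0 := hR ∅
    simp only [card_empty, Nat.cast_zero, mul_zero, missingRows, filter_empty] at h0
    have h1 : ∀ ℓ ∈ univ, min (((ρ ℓ : ℚ) - occ L ℓ - d ℓ) / 2) 0 ≤ 0 :=
      fun ℓ _ => min_le_right _ _
    have h2 := (sum_eq_zero_iff_of_nonpos h1).1 (le_antisymm (sum_nonpos h1) h0)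
    intro ℓ
    have h3 := min_eq_right_iff.1 (h2 ℓ (mem_univ _))
    have : (occ L ℓ : ℚ) + d ℓ ≤ ρ ℓ := by linarith
    exact_mod_cast this
  have hhi : ∀ ℓ, ∃ x, ρ ℓ = occ L ℓ + d ℓ + 2 * x := by
    intro ℓ
    have h1 := Int.modEq_zero_iff_dvd.1 (hA.2 ℓ)
    have h2 := hd ℓ
    exact ⟨(ρ ℓ - occ L ℓ - d ℓ) / 2, by omega⟩
  choose hi hhi using hhi
  have hhiQ : ∀ ℓ, ((ρ ℓ : ℚ) - occ L ℓ - d ℓ) / 2 = hi ℓ := fun ℓ => by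
    rw [hhi ℓ]; push_cast; ring
  have hloQ : ∀ ℓ, monus ((ρ ℓ : ℚ) - occ L ℓ + r) (r + m : ℕ) =
      (ρ ℓ - occ L ℓ - m : ℕ) := fun ℓ => by
    rw [monus, Nat.sub_sub]
    have h1 : (ρ ℓ : ℚ) - occ L ℓ + r - (r + m : ℕ) = ρ ℓ - (occ L ℓ + m : ℕ) := by
      push_cast; ring
    rw [h1]
    rcases le_total (occ L ℓ + m) (ρ ℓ) with h | h
    · rw [Nat.cast_sub h, max_eq_right]
      rw [sub_nonneg]
      exact_mod_cast h
    · rw [Nat.sub_eq_zero_of_le h, Nat.cast_zero, max_eq_left]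
      rw [sub_nonpos]
      exact_mod_cast h
  have hR' : ∀ I : Finset (Fin r), m * #I ≤ ∑ ℓ, min (hi ℓ) (missingRows L I ℓ) := fun I => by
    have := hR I
    simp only [hm, hhiQ] at this
    exact_mod_cast this
  have hS' : ∀ K : Finset (Fin k), ∑ ℓ ∈ K, (ρ ℓ - occ L ℓ - m) ≤
      ∑ i, min m (missingSymbols L K i) := fun K => by
    have := hS K
    simp only [hm, hloQ] at this
    exact_mod_cast this
  let N : Fin r → Finset (Fin k) := fun i => {ℓ | Missing L i ℓ}
  have hN : ∀ i K, #(N i \ K) = missingSymbols L Kᶜ i := fun i K => by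
    rw [missingSymbols]
    congr 1
    ext ℓ
    simp [N, and_comm]
  obtain ⟨H, hHN, hHm, hHlo⟩ := exists_subgraph_of_degree_bounds N (fun _ => m)
    (fun ℓ => ρ ℓ - occ L ℓ - m) hi
    (fun ℓ => by
      have := hA.1 ℓ
      have := hhi ℓ
      push_cast at *
      omega)
    (fun I K => by
      simp only [hN, sum_missingSymbols, sum_const, smul_eq_mul]
      rw [mul_comm]
      refine (hR' I).trans ?_
      rw [← sum_compl_add_sum K]
      gcongr
      · exact min_le_right _ _
      · exact min_le_left _ _)
    (fun I K => by
      simp only [hN]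
      refine (hS' Kᶜ).trans ?_
      rw [← sum_compl_add_sum I]
      gcongr
      · exact min_le_left _ _
      · exact min_le_right _ _)
  refine ⟨H, fun ℓ => hi ℓ - #{i | ℓ ∈ H i}, fun i ℓ hℓ => (mem_filter.1 (hHN i hℓ)).2, hHm,
    fun ℓ => ?_, fun ℓ => ?_⟩
  · have := hhi ℓ
    have := hHlo ℓ
    omega
  · have := hhi ℓ
    have := hHlo ℓ
    omega

/-! ### The outline of a completion -/

theorem exists_sum_eq_diagonal_add_two_mul {m : ℕ} (f : Fin m → Fin m → ℕ)
    (hf : ∀ i j, f i j = f j i) : ∃ c, ∑ i, ∑ j, f i j = ∑ i, f i i + 2 * c := by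
  induction m with
  | zero => exact ⟨0, by simp⟩
  | succ m ih =>
    obtain ⟨c, hc⟩ := ih (fun i j => f i.castSucc j.castSucc) fun i j => hf _ _
    refine ⟨c + ∑ i : Fin m, f i.castSucc (Fin.last m), ?_⟩
    simp only [Fin.sum_univ_castSucc, sum_add_distrib, hc,
      fun j : Fin m => hf (Fin.last m) j.castSucc]
    ring

theorem sum_boole_eq_mem_image {α β : Type*} [Fintype α] [DecidableEq β] {f : α → β}
    (hf : Function.Injective f) (b : β) :
    ∑ a, (if f a = b then 1 else 0) = if b ∈ univ.image f then 1 else 0 := by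
  classical
  split_ifs with h
  · obtain ⟨a, -, rfl⟩ := mem_image.1 h
    simp [hf.eq_iff]
  · refine sum_eq_zero fun a _ => if_neg fun hab => h ?_
    exact mem_image.2 ⟨a, mem_univ _, hab⟩

/-- Merging the last `m` indices of a completion gives an outline: `H i` is the set of symbols of
row `i` in the top right block, and `c ℓ` counts the pairs of symmetric off-diagonal cells of the
bottom right block that contain `ℓ`. -/
theorem outline_of_completableWithTail {r m k : ℕ} {ρ d : Fin k → ℕ}
    {L : Matrix (Fin r) (Fin r) (Fin k)}
    (h : CompletableWithTail (Nat.le_add_right r m) ρ d L) : ∃ H c, Outline m ρ d L H c := by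
  obtain ⟨L', hsq, hsymm, hext, htail⟩ := h
  have hext' : ∀ i j : Fin r, L' (Fin.castAdd m i) (Fin.castAdd m j) = L i j := hext
  have hd : ∀ ℓ, d ℓ = ∑ j : Fin m,
      if L' (Fin.natAdd r j) (Fin.natAdd r j) = ℓ then 1 else 0 := fun ℓ => by
    rw [← htail, diagonalTail, card_filter, Fin.sum_univ_add]
    simp
  have hc : ∀ ℓ, ∃ c, (∑ i : Fin m, ∑ j : Fin m,
      if L' (Fin.natAdd r i) (Fin.natAdd r j) = ℓ then 1 else 0) = d ℓ + 2 * c := fun ℓ => by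
    rw [hd]
    exact exists_sum_eq_diagonal_add_two_mul
      (fun i j => if L' (Fin.natAdd r i) (Fin.natAdd r j) = ℓ then 1 else 0)
      fun i j => by rw [hsymm.apply]
  choose c hc using hc
  have hinj : ∀ i : Fin r, Function.Injective fun j : Fin m =>
      L' (Fin.castAdd m i) (Fin.natAdd r j) := fun i j j' hj =>
    Fin.natAdd_injective _ _ (hsq.row _ hj)
  let H : Fin r → Finset (Fin k) := fun i =>
    univ.image fun j : Fin m => L' (Fin.castAdd m i) (Fin.natAdd r j)
  have hH : ∀ ℓ, #{i | ℓ ∈ H i} = ∑ i : Fin r, ∑ j : Fin m,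
      if L' (Fin.castAdd m i) (Fin.natAdd r j) = ℓ then 1 else 0 := fun ℓ => by
    rw [card_filter]
    exact sum_congr rfl fun i _ => (sum_boole_eq_mem_image (hinj i) ℓ).symm
  refine ⟨H, c, fun i ℓ hℓ j hj => ?_, fun i => ?_, fun ℓ => ?_, fun ℓ => ?_⟩
  · obtain ⟨j', -, rfl⟩ := mem_image.1 hℓ
    rw [← hext'] at hj
    have := congrArg Fin.val (hsq.row _ hj)
    simp only [Fin.val_castAdd, Fin.val_natAdd] at this
    omega
  · rw [card_image_of_injective _ (hinj i), card_univ, Fintype.card_fin]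
  · rw [← hsq.occ_eq ℓ, occ_eq_sum, occ_eq_sum, hH]
    simp only [Fin.sum_univ_add, sum_add_distrib, hext', hc]
    have : (∑ i : Fin m, ∑ j : Fin r,
        if L' (Fin.natAdd r i) (Fin.castAdd m j) = ℓ then 1 else 0) =
        ∑ i : Fin r, ∑ j : Fin m,
          if L' (Fin.castAdd m i) (Fin.natAdd r j) = ℓ then 1 else 0 := by
      rw [sum_comm]
      exact sum_congr rfl fun i _ => sum_congr rfl fun j _ => by rw [hsymm.apply]
    rw [this]
    ring
  · have h1 : ∀ j : Fin m, (∑ i, if L' i (Fin.natAdd r j) = ℓ then 1 else 0) ≤ 1 :=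
      fun j => by
        rw [sum_boole_eq_mem_image (hsq.col _)]
        split_ifs <;> simp
    have h2 := sum_le_sum fun j (_ : j ∈ (univ : Finset (Fin m))) => h1 j
    simp only [Fin.sum_univ_add, sum_add_distrib, sum_const, card_univ, Fintype.card_fin,
      smul_eq_mul, mul_one] at h2
    -- `ℓ` occurs at most once in each of the last `m` columns.
    have h3 := hH ℓ
    rw [sum_comm] at h3
    have h4 := hc ℓ
    rw [sum_comm] at h4
    omega

/-! ### Completing an outline -/

/-- One step of the completion. The new row has `r + m + 1` cells: one for each old column, `m`
for the later columns and one on the diagonal. Spreading the symbols of an outline evenly over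
the `m + 1` rows that are to be added gives the weights `[ℓ ∈ H i] / (m + 1)`,
`2 c ℓ / (m (m + 1))` and `d ℓ / (m + 1)` on these cells; each cell has total weight one and each
symbol total weight at most one, so the weights can be rounded to a choice of distinct symbols.
The symbols of full degree `m + 1` have total weight one, hence are used, which keeps the degrees
bounded by the number `m` of rows that remain. -/
theorem Outline.exists_extension {r m k : ℕ} {ρ d : Fin k → ℕ}
    {L : Matrix (Fin r) (Fin r) (Fin k)} {H : Fin r → Finset (Fin k)} {c : Fin k → ℕ}
    (h : Outline (m + 1) ρ d L H c) (hsymm : L.IsSymm)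
    (hrow : ∀ i, Function.Injective fun j => L i j)
    (hρ : ∑ ℓ, ρ ℓ = (r + (m + 1)) ^ 2) (hd : ∑ ℓ, d ℓ = m + 1) :
    ∃ (L₁ : Matrix (Fin (r + 1)) (Fin (r + 1)) (Fin k)) (d₁ : Fin k → ℕ)
      (H₁ : Fin (r + 1) → Finset (Fin k)) (c₁ : Fin k → ℕ),
      Outline m ρ d₁ L₁ H₁ c₁ ∧ L₁.IsSymm ∧ (∀ i, Function.Injective fun j => L₁ i j) ∧
      (∀ i j : Fin r, L₁ i.castSucc j.castSucc = L i j) ∧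
      ∀ ℓ, d ℓ = d₁ ℓ + if L₁ (Fin.last r) (Fin.last r) = ℓ then 1 else 0 := by
  have hc : 2 * ∑ ℓ, c ℓ = m * (m + 1) := by
    have := h.sum_eq hρ hd
    linarith
  let w : Fin r ⊕ Fin m ⊕ Unit → Fin k → ℚ := Sum.elim
    (fun i ℓ => (if ℓ ∈ H i then 1 else 0) / (m + 1))
    (Sum.elim (fun _ ℓ => 2 * c ℓ / (m * (m + 1))) fun _ ℓ => d ℓ / (m + 1))
  have hm : (0 : ℚ) < m + 1 := by positivity
  have hwcol : ∀ ℓ, ∑ s, w s ℓ = (#{i | ℓ ∈ H i} + 2 * c ℓ + d ℓ : ℕ) / (m + 1) := by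
    intro ℓ
    simp only [w, Fintype.sum_sum_type, Sum.elim_inl, Sum.elim_inr, ← sum_div, sum_boole,
      sum_const, card_univ, Fintype.card_fin, Fintype.card_unit, nsmul_eq_mul]
    push_cast
    -- For `m = 0` there are no later columns, and `c ℓ` has to vanish.
    rcases Nat.eq_zero_or_pos m with rfl | hm0
    · have : c ℓ = 0 := by
        have h0 : ∑ ℓ, c ℓ = 0 := by omega
        exact sum_eq_zero_iff.1 h0 ℓ (mem_univ _)
      simp [this]
    · have : (0 : ℚ) < m := by exact_mod_cast hm0
      field_simp
      ring
  obtain ⟨f, hf, hfpos, hfcover⟩ := exists_injective_of_fractional w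
    (by
      rintro (i | j | u) ℓ
      · simp only [w, Sum.elim_inl]
        split_ifs <;> positivity
      · simp only [w, Sum.elim_inl, Sum.elim_inr]
        positivity
      · simp only [w, Sum.elim_inr]
        positivity)
    (by
      rintro (i | j | u)
      · simp only [w, Sum.elim_inl, ← sum_div, sum_boole, filter_univ_mem, h.card_row]
        push_cast
        exact div_self hm.ne'
      · have hm0 : (0 : ℚ) < m := by exact_mod_cast j.pos
        have hcQ : (2 : ℚ) * ∑ ℓ, (c ℓ : ℚ) = m * (m + 1) := by exact_mod_cast hc
        simp only [w, Sum.elim_inl, Sum.elim_inr, ← sum_div, ← mul_sum]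
        rw [hcQ]
        exact div_self (by positivity)
      · have hdQ : ∑ ℓ, (d ℓ : ℚ) = m + 1 := by exact_mod_cast hd
        simp only [w, Sum.elim_inr, ← sum_div]
        rw [hdQ]
        exact div_self hm.ne')
    (fun ℓ => by
      rw [hwcol, div_le_one hm]
      exact_mod_cast h.le_order ℓ)
  -- `g`, `t` and `ℓ₀` are the symbols of the old columns, of the later ones and of the diagonal.
  let g : Fin r → Fin k := fun i => f (Sum.inl i)
  let t : Fin m → Fin k := fun j => f (Sum.inr (Sum.inl j))
  let ℓ₀ : Fin k := f (Sum.inr (Sum.inr ()))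
  have hg : Function.Injective g := fun i j hij => Sum.inl_injective (hf hij)
  have ht : Function.Injective t := fun i j hij =>
    Sum.inl_injective (Sum.inr_injective (hf hij))
  have hgℓ₀ : ∀ i, g i ≠ ℓ₀ := fun i hi => by simpa using hf hi
  have htℓ₀ : ∀ j, t j ≠ ℓ₀ := fun i hi => by simpa using hf hi
  have hgt : ∀ i j, g i ≠ t j := fun i j hi => by simpa using hf hi
  have hgH : ∀ i, g i ∈ H i := fun i => by
    by_contra hi
    have := hfpos (Sum.inl i)
    simp only [w, Sum.elim_inl] at this
    rw [if_neg hi] at this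
    simp at this
  have htc : ∀ j, 0 < c (t j) := fun j => by
    by_contra hj
    have := hfpos (Sum.inr (Sum.inl j))
    simp only [w, Sum.elim_inl, Sum.elim_inr] at this
    rw [show c (f (Sum.inr (Sum.inl j))) = 0 from Nat.eq_zero_of_not_pos hj] at this
    simp at this
  have hℓ₀d : 0 < d ℓ₀ := by
    by_contra hj
    have := hfpos (Sum.inr (Sum.inr ()))
    simp only [w, Sum.elim_inr] at this
    rw [show d (f (Sum.inr (Sum.inr ()))) = 0 from Nat.eq_zero_of_not_pos hj] at this
    simp at this
  let T : Finset (Fin k) := univ.image t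
  let L₁ : Matrix (Fin (r + 1)) (Fin (r + 1)) (Fin k) :=
    Fin.snoc (α := fun _ => Fin (r + 1) → Fin k)
      (fun i => Fin.snoc (α := fun _ => Fin k) (fun j => L i j) (g i))
      (Fin.snoc (α := fun _ => Fin k) g ℓ₀)
  have hL₁ : ∀ i j : Fin r, L₁ i.castSucc j.castSucc = L i j := fun i j => by simp [L₁]
  have hL₁r : ∀ i : Fin r, L₁ i.castSucc (Fin.last r) = g i := fun i => by simp [L₁]
  have hL₁c : ∀ j : Fin r, L₁ (Fin.last r) j.castSucc = g j := fun j => by simp [L₁]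
  have hL₁l : L₁ (Fin.last r) (Fin.last r) = ℓ₀ := by simp [L₁]
  let H₁ : Fin (r + 1) → Finset (Fin k) :=
    Fin.snoc (α := fun _ => Finset (Fin k)) (fun i => (H i).erase (g i)) T
  have hH₁ : ∀ i : Fin r, H₁ i.castSucc = (H i).erase (g i) := fun i => by simp [H₁]
  have hH₁l : H₁ (Fin.last r) = T := by simp [H₁]
  have hcol : ∀ ℓ, #{i | ℓ ∈ H i} = (∑ i, if ℓ ∈ (H i).erase (g i) then 1 else 0) +
      ∑ i, if g i = ℓ then 1 else 0 := fun ℓ => by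
    rw [card_filter, ← sum_add_distrib]
    refine sum_congr rfl fun i _ => ?_
    by_cases hi : g i = ℓ
    · subst hi; simp [hgH]
    · simp [hi, Ne.symm hi]
  have hcol₁ : ∀ ℓ, #{i | ℓ ∈ H₁ i} = (∑ i, if ℓ ∈ (H i).erase (g i) then 1 else 0) +
      if ℓ ∈ T then 1 else 0 := fun ℓ => by
    rw [card_filter, Fin.sum_univ_castSucc]
    simp only [hH₁, hH₁l]
  have hTc : ∀ ℓ, (if ℓ ∈ T then 1 else 0) ≤ c ℓ := fun ℓ => by
    split_ifs with hℓ
    · obtain ⟨j, -, rfl⟩ := mem_image.1 hℓ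
      exact htc j
    · exact Nat.zero_le _
  have hd₁ : ∀ ℓ, (if ℓ₀ = ℓ then 1 else 0) ≤ d ℓ := fun ℓ => by
    split_ifs with hℓ
    · exact hℓ ▸ hℓ₀d
    · exact Nat.zero_le _
  refine ⟨L₁, fun ℓ => d ℓ - if ℓ₀ = ℓ then 1 else 0, H₁,
    fun ℓ => c ℓ - if ℓ ∈ T then 1 else 0, ⟨?_, ?_, ?_, ?_⟩, ?_, ?_, hL₁, ?_⟩
  · intro i ℓ hℓ j
    induction i using Fin.lastCases with
    | last =>
      rw [hH₁l] at hℓ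
      obtain ⟨j', -, rfl⟩ := mem_image.1 hℓ
      induction j using Fin.lastCases with
      | last => rw [hL₁l]; exact (htℓ₀ j').symm
      | cast j => rw [hL₁c]; exact hgt j j'
    | cast i =>
      rw [hH₁, mem_erase] at hℓ
      induction j using Fin.lastCases with
      | last => rw [hL₁r]; exact hℓ.1.symm
      | cast j => rw [hL₁]; exact h.missing i ℓ hℓ.2 j
  · intro i
    induction i using Fin.lastCases with
    | last => rw [hH₁l, card_image_of_injective _ ht, card_univ, Fintype.card_fin]
    | cast i => rw [hH₁, card_erase_of_mem (hgH i), h.card_row, Nat.add_sub_cancel]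
  · intro ℓ
    have h1 : occ L₁ ℓ = occ L ℓ + 2 * (∑ i, if g i = ℓ then 1 else 0) +
        if ℓ₀ = ℓ then 1 else 0 := by
      simp only [occ_eq_sum, Fin.sum_univ_castSucc, sum_add_distrib, hL₁, hL₁r, hL₁c, hL₁l]
      ring
    have h2 := h.occ_eq ℓ
    have h3 := hcol ℓ
    have h4 := hcol₁ ℓ
    have h5 := hTc ℓ
    have h6 := hd₁ ℓ
    omega
  · intro ℓ
    have h2 := h.le_order ℓ
    have h3 := hcol ℓ
    have h4 := hcol₁ ℓ
    have h5 := hTc ℓ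
    have h6 := hd₁ ℓ
    -- A symbol of full degree `m + 1` is used by the new row, so its degree drops.
    have h7 : #{i | ℓ ∈ H i} + 2 * c ℓ + d ℓ = m + 1 →
        1 ≤ (∑ i, if g i = ℓ then 1 else 0) + (if ℓ ∈ T then 1 else 0) +
          if ℓ₀ = ℓ then 1 else 0 := by
      intro htight
      obtain ⟨s, hs⟩ := hfcover ℓ (by
        rw [hwcol, htight]
        push_cast
        exact div_self hm.ne')
      rcases s with i | j | u
      · have : 1 ≤ ∑ i, if g i = ℓ then 1 else 0 := by
          refine le_trans ?_ (single_le_sum (fun _ _ => Nat.zero_le _) (mem_univ i))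
          exact (if_pos hs).ge
        omega
      · have : ℓ ∈ T := mem_image.2 ⟨j, mem_univ _, hs⟩
        rw [if_pos this]
        omega
      · have : ℓ₀ = ℓ := hs
        rw [if_pos this]
        omega
    omega
  · refine Matrix.IsSymm.ext fun i j => ?_
    induction i using Fin.lastCases with
    | last =>
      induction j using Fin.lastCases with
      | last => rfl
      | cast j => rw [hL₁r, hL₁c]
    | cast i =>
      induction j using Fin.lastCases with
      | last => rw [hL₁r, hL₁c]
      | cast j => rw [hL₁, hL₁, hsymm.apply]
  · intro i
    induction i using Fin.lastCases with
    | last =>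
      have : L₁ (Fin.last r) = Fin.snoc (α := fun _ => Fin k) g ℓ₀ := by simp [L₁]
      simp only [this]
      exact Fin.snoc_injective_of_injective hg fun ⟨i, hi⟩ => hgℓ₀ i hi
    | cast i =>
      have : L₁ i.castSucc = Fin.snoc (α := fun _ => Fin k) (fun j => L i j) (g i) := by
        simp [L₁]
      simp only [this]
      exact Fin.snoc_injective_of_injective (hrow i) fun ⟨j, hj⟩ =>
        h.missing i _ (hgH i) j hj
  · intro ℓ
    rw [hL₁l]
    exact (Nat.sub_add_cancel (hd₁ ℓ)).symm

theorem diagonalTail_eq_add {n k r : ℕ} (hr : r < n) (L' : Matrix (Fin n) (Fin n) (Fin k))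
    (ℓ : Fin k) : diagonalTail r L' ℓ =
      diagonalTail (r + 1) L' ℓ + if L' ⟨r, hr⟩ ⟨r, hr⟩ = ℓ then 1 else 0 := by
  have h : (if L' ⟨r, hr⟩ ⟨r, hr⟩ = ℓ then 1 else 0) =
      ∑ i : Fin n, if ⟨r, hr⟩ = i then (if L' i i = ℓ then 1 else 0) else 0 := by
    rw [sum_ite_eq, if_pos (mem_univ _)]
  rw [diagonalTail, diagonalTail, card_filter, card_filter, h, ← sum_add_distrib]
  refine sum_congr rfl fun i _ => ?_
  rcases lt_trichotomy r i with hi | hi | hi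
  · have : (⟨r, hr⟩ : Fin n) ≠ i := fun h => hi.ne (congrArg Fin.val h)
    simp [this, hi.le, Nat.succ_le_of_lt hi]
  · have : (⟨r, hr⟩ : Fin n) = i := Fin.ext hi
    simp [this, ← hi]
  · have : (⟨r, hr⟩ : Fin n) ≠ i := fun h => hi.ne (congrArg Fin.val h).symm
    have h1 : ¬ r ≤ i := not_le.2 hi
    have h2 : ¬ r + 1 ≤ i := by omega
    simp [this, h1, h2]

/-- Every outline comes from a completion: add the `m` rows and columns one at a time. -/
theorem Outline.completableWithTail {m : ℕ} : ∀ {r n k : ℕ} (hrn : r ≤ n) (_ : r + m = n)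
    {ρ d : Fin k → ℕ} {L : Matrix (Fin r) (Fin r) (Fin k)} {H : Fin r → Finset (Fin k)}
    {c : Fin k → ℕ} (_ : Outline m ρ d L H c) (_ : L.IsSymm)
    (_ : ∀ i, Function.Injective fun j => L i j) (_ : ∑ ℓ, ρ ℓ = n ^ 2)
    (_ : ∑ ℓ, d ℓ = m), CompletableWithTail hrn ρ d L := by
  induction m with
  | zero =>
    intro r n k hrn hn ρ d L H c h hsymm hrow hρ hd
    obtain rfl : r = n := hn
    refine ⟨L, ⟨hrow, fun j a b hab => hrow j ?_, fun ℓ => ?_⟩, hsymm, fun i j => rfl, ?_⟩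
    · simpa only [hsymm.apply] using hab
    · have h1 := h.occ_eq ℓ
      have h2 := h.le_order ℓ
      omega
    · funext ℓ
      have h2 := h.le_order ℓ
      have h3 : diagonalTail r L ℓ = 0 := by
        rw [diagonalTail, card_eq_zero, filter_eq_empty_iff]
        rintro i - ⟨hi, -⟩
        exact absurd i.2 (not_lt.2 hi)
      omega
  | succ m ih =>
    intro r n k hrn hn ρ d L H c h hsymm hrow hρ hd
    subst hn
    obtain ⟨L₁, d₁, H₁, c₁, h₁, hsymm₁, hrow₁, hL₁, hd₁⟩ :=
      h.exists_extension hsymm hrow hρ hd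
    have hsum : ∑ ℓ, d₁ ℓ = m := by
      rw [sum_congr rfl fun ℓ _ => hd₁ ℓ, sum_add_distrib, sum_ite_eq,
        if_pos (mem_univ _)] at hd
      omega
    obtain ⟨L', hsq, hsymm', hext, htail⟩ :=
      ih (r := r + 1) (n := r + (m + 1)) (by omega) (by omega) h₁ hsymm₁ hrow₁ hρ hsum
    refine ⟨L', hsq, hsymm', fun i j => ?_, ?_⟩
    · rw [← hL₁, ← hext]
      rfl
    · funext ℓ
      rw [diagonalTail_eq_add (by omega), htail, hd₁, ← hext]
      rfl

end RhoLatin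

theorem mainTheorem2 (n k r : ℕ) (hn : 0 < n) (hnk : n ≤ k) (hrn : r ≤ n)
    (ρ : Fin k → ℕ) (hρ : ∀ ℓ, 1 ≤ ρ ℓ ∧ ρ ℓ ≤ n) (hρsum : ∑ ℓ, ρ ℓ = n ^ 2)
    (d : Fin k → ℕ) (hd : ∑ ℓ, d ℓ = n - r)
    (L : Matrix (Fin r) (Fin r) (Fin k)) (hL : RhoLatin.IsRectangle ρ L) (hsymm : L.IsSymm) :
    (RhoLatin.CompletableWithTail hrn ρ d L ↔
      RhoLatin.Admissible n ρ d L ∧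
        ((RhoLatin.RowCondition n ρ d L ∧ RhoLatin.SymbolCondition n ρ L) ∨
          RhoLatin.JointCondition n ρ d L)) ∧
    (RhoLatin.Admissible n ρ d L →
      ((RhoLatin.RowCondition n ρ d L ∧ RhoLatin.SymbolCondition n ρ L) ↔
        RhoLatin.JointCondition n ρ d L)) := by
  obtain ⟨m, rfl⟩ := Nat.exists_eq_add_of_le hrn
  rw [Nat.add_sub_cancel_left] at hd
  refine ⟨⟨fun h => ?_, fun ⟨hA, h⟩ => ?_⟩, fun hA => ⟨fun h => ?_, fun h => ?_⟩⟩
  · obtain ⟨H, c, hO⟩ := RhoLatin.outline_of_completableWithTail h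
    exact ⟨hO.admissible, Or.inr hO.jointCondition⟩
  · have hRS := h.elim id fun hJ => ⟨hJ.rowCondition, hJ.symbolCondition⟩
    obtain ⟨H, c, hO⟩ := RhoLatin.exists_outline hA hRS.1 hRS.2
    exact hO.completableWithTail hrn rfl hsymm hL.row hρsum hd
  · obtain ⟨H, c, hO⟩ := RhoLatin.exists_outline hA h.1 h.2
    exact hO.jointCondition
  · exact ⟨h.rowCondition, h.symbolCondition⟩
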